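/- **Corollary 1.3.** Let $\mu$ be a probability measure on $\mathbb{R}$ whose support is compact and infinite. Let $P_n$ be its monic orthogonal polynomials, $p_n=P_n/\|P_n\|_{L^2(\mu)}$ its orthonormal polynomials, and $a_n=\|P_n\|_{L^2(\mu)}/\|P_{n-1}\|_{L^2(\mu)}$ $(n\ge 1)$ its off-diagonal Jacobi parameters. Write $d\mu(x)=w(x)\,dx+d\mu_{\mathrm s}(x)$ with $\mu_{\mathrm s}$ singular with respect to Lebesgue measure. For functions $f_\pm$ on a set $I\subseteq\mathbb{R}$, say that $$\pi^{-1}f_-\le\liminf_{n\to\infty}\bigl(a_n^2p_n^2+p_{n-1}^2\bigr)\le\limsup_{n\to\infty}\bigl(a_n^2p_n^2+p_{n-1}^2\bigr)\le\pi^{-1}f_+ \qquad (*)$$ holds uniformly on $I$ if for every $\varepsilon>0$ there is an $N$ such that $$\pi^{-1}f_-(x)-\varepsilon\le a_n^2p_n(x)^2+p_{n-1}(x)^2\le\pi^{-1}f_+(x)+\varepsilon\qquad\text{for all } n\ge N \text{ and all } x\in I.$$ (i) Let $f_\pm$ be continuous and strictly positive on $[\alpha,\beta]$, and suppose that $(*)$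 holds uniformly on $[\alpha,\beta]$. Then $\mu$ is purely absolutely continuous on $(\alpha,\beta)$, and $$\frac1{f_+(x)}\le w(x)\le\frac1{f_-(x)}\qquad\text{for Lebesgue-a.e. } x\in(\alpha,\beta).$$ (ii) Let $g,h$ be real functions such that $f_\pm=e^{2(g\pm h)}$ are continuous on $(x_0,x_1)$ (for instance with $x_1=2$), and suppose that $(*)$ holds uniformly on each compact interval $[\alpha,\beta]\subset(x_0,x_1)$. Then $\mu$ is purely absolutely continuous on $(x_0,x_1)$ and, with $Q=-\tfrac12\log w$, one has $w(x)=e^{-2Q(x)}$ and $$|Q(x)-g(x)|\le h(x)\qquad\text{for Lebesgue-a.e. } x\in(x_0,x_1).$$ -/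

import Mathlib

open MeasureTheory Set Polynomial

noncomputable section

namespace JacobiWeight

/-- The pairing `⟨p, q⟩ = ∫ p(x) q(x) dμ(x)` of real polynomials in `L²(μ)`. -/
def pairing (μ : Measure ℝ) (p q : ℝ[X]) : ℝ :=
  ∫ x, p.eval x * q.eval x ∂μ

/-- The norm `‖p‖` of a real polynomial in `L²(μ)`. -/
def polyNorm (μ : Measure ℝ) (p : ℝ[X]) : ℝ :=
  Real.sqrt (pairing μ p p)

/-- The monic orthogonal polynomials `Pₙ(x, dμ)`, obtained from the monomials `1, x, x², …`
by the Gram-Schmidt process in `L²(μ)`. -/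
def monicPoly (μ : Measure ℝ) (n : ℕ) : ℝ[X] :=
  X ^ n - ∑ k : Fin n,
    C (pairing μ (X ^ n) (monicPoly μ k) / pairing μ (monicPoly μ k) (monicPoly μ k)) *
      monicPoly μ k
termination_by n
decreasing_by exact k.2

/-- The orthonormal polynomials `pₙ = Pₙ / ‖Pₙ‖`. -/
def orthoPoly (μ : Measure ℝ) (n : ℕ) : ℝ[X] :=
  C (polyNorm μ (monicPoly μ n))⁻¹ * monicPoly μ n

/-- The off-diagonal Jacobi parameters `aₙ = ‖Pₙ‖ / ‖Pₙ₋₁‖`, `n ≥ 1`, so that for a probability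
measure `‖Pₙ‖ = a₁ ⋯ aₙ`. (The value at `n = 0` is irrelevant.) -/
def jacobiA (μ : Measure ℝ) (n : ℕ) : ℝ :=
  polyNorm μ (monicPoly μ n) / polyNorm μ (monicPoly μ (n - 1))

/-- The function `aₙ² pₙ(x)² + pₙ₋₁(x)²`, for `n ≥ 1`. -/
def amplitude (μ : Measure ℝ) (n : ℕ) (x : ℝ) : ℝ :=
  jacobiA μ n ^ 2 * (orthoPoly μ n).eval x ^ 2 + (orthoPoly μ (n - 1)).eval x ^ 2

/-- `lo ≤ liminf Sₙ ≤ limsup Sₙ ≤ hi` uniformly on `s`: for every `ε > 0`, all sufficiently late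
`Sₙ` lie between `lo - ε` and `hi + ε` on all of `s` simultaneously. -/
def UniformlyBetween (S : ℕ → ℝ → ℝ) (lo hi : ℝ → ℝ) (s : Set ℝ) : Prop :=
  ∀ ε > 0, ∃ N : ℕ, ∀ n ≥ N, ∀ x ∈ s, lo x - ε ≤ S n x ∧ S n x ≤ hi x + ε

/-- The weight `w` of `dμ = w(x) dx + dμ_s`: the density of the absolutely continuous part in the
Lebesgue decomposition of `μ`. -/
def weight (μ : Measure ℝ) (x : ℝ) : ℝ :=
  (μ.rnDeriv volume x).toReal

/-- The exponent `Q` in `w = exp (-2 Q)`, that is `Q = -(1/2) log w`. -/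
def exponent (μ : Measure ℝ) (x : ℝ) : ℝ :=
  -(1 / 2) * Real.log (weight μ x)

end JacobiWeight

end

namespace JacobiWeight

open Filter Topology

variable {μ : Measure ℝ}

/-! The proof rests on Carmona's approximation of `μ` by the densities `1 / (π (aₙ² pₙ² + pₙ₋₁²))`.
Write `D = P_{m+1} + i P_m`. Testing against orthogonality shows that `D` has no zeros in the closed
upper half-plane (`carmonaPoly_eval_ne_zero`), and on the real line `|D|² = P_{m+1}² + P_m²` is, up
to a constant, the amplitude. Cauchy's theorem applied to `u / D` and a Bézout decomposition `r = u
P_{m+1} + v P_m` then show that the density with `n = m + 1` integrates every polynomial of degree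
at most `2m` exactly as `μ` does (`integral_div_carmonaDenom`).

Matching moments plus compact support of `μ` give convergence against compactly supported continuous
functions (`tendsto_integral_mul_carmonaDensity`). The uniform bounds on the amplitude pass to the
limit and sandwich `μ` on the interval between `dx / f₊` and `dx / f₋`. The upper bound excludes a
singular part, and both bounds pass to the Radon-Nikodym derivative. The second statement follows by
exhausting the open interval and taking logarithms. -/

/-! ### Rational functions without poles in the closed upper half-plane -/

lemma exists_norm_eval_div_le {f E : ℂ[X]} (h : f.natDegree + 2 ≤ E.natDegree) :
    ∃ C R₀ : ℝ, 0 < C ∧ 0 < R₀ ∧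
      ∀ z : ℂ, R₀ ≤ ‖z‖ → ‖f.eval z / E.eval z‖ ≤ C / ‖z‖ ^ 2 := by
  have hE : E ≠ 0 := by rintro rfl; simp at h
  have hdeg : (X ^ 2 * f).degree ≤ E.degree := by
    refine degree_le_of_natDegree_le ?_ |>.trans (degree_eq_natDegree hE).ge
    exact (natDegree_mul_le.trans (by simp; omega))
  obtain ⟨C, hC, hb⟩ := (isBigO_cobounded_of_degree_le hdeg).exists_pos
  obtain ⟨R, hR⟩ := (hasBasis_cobounded_norm.eventually_iff.1 hb.bound)
  refine ⟨C, max R 1, hC, by positivity, fun z hz => ?_⟩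
  have hz1 : 1 ≤ ‖z‖ := le_trans (le_max_right _ _) hz
  have := hR.2 (show z ∈ {x | R ≤ ‖x‖} from le_trans (le_max_left _ _) hz)
  simp only [eval_mul, eval_pow, eval_X, norm_mul, norm_pow] at this
  rw [norm_div]
  by_cases h0 : E.eval z = 0
  · simp only [h0, norm_zero, div_zero]; positivity
  · rw [div_le_div_iff₀ (norm_pos_iff.2 h0) (by positivity)]
    linarith

lemma integrable_eval_div_eval {f E : ℂ[X]} (h : f.natDegree + 2 ≤ E.natDegree)
    (hE : ∀ x : ℝ, E.eval (x : ℂ) ≠ 0) :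
    Integrable (fun x : ℝ => f.eval (x : ℂ) / E.eval (x : ℂ)) := by
  obtain ⟨C, R₀, hC, hR₀, hb⟩ := exists_norm_eval_div_le h
  have hc : Continuous (fun x : ℝ => f.eval (x : ℂ) / E.eval (x : ℂ)) :=
    (f.continuous.comp Complex.continuous_ofReal).div
      (E.continuous.comp Complex.continuous_ofReal) hE
  refine hc.locallyIntegrable.integrable_of_isBigO_cocompact
    (g := fun x : ℝ => (1 + x ^ 2)⁻¹) ?_ (integrable_inv_one_add_sq.integrableAtFilter _)
  refine Asymptotics.IsBigO.of_bound (2 * C) ?_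
  rw [← Metric.cobounded_eq_cocompact]
  filter_upwards [hasBasis_cobounded_norm.mem_of_mem (i := max R₀ 1) trivial] with x hx
  have hx' : max R₀ 1 ≤ |x| := hx
  have h1 : 1 ≤ |x| := le_trans (le_max_right _ _) hx'
  have := hb x (by simpa using le_trans (le_max_left _ _) hx')
  refine this.trans ?_
  simp only [Complex.norm_real, Real.norm_eq_abs, sq_abs, abs_inv]
  have h2 : 1 ≤ x ^ 2 := by rw [← sq_abs]; nlinarith
  rw [abs_of_pos (by positivity), ← div_eq_mul_inv, div_le_div_iff₀ (by positivity) (by positivity)]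
  nlinarith

/-- Cauchy's theorem on the rectangle `[-R, R] × [0, R]`: the integrand is `O(R⁻²)` on the three
sides off the real axis, whose total length is `4R`, so they contribute at most `4C / R`. -/
theorem integral_eval_div_eval_eq_zero {f E : ℂ[X]} (h : f.natDegree + 2 ≤ E.natDegree)
    (hE : ∀ z : ℂ, 0 ≤ z.im → E.eval z ≠ 0) :
    ∫ x : ℝ, f.eval (x : ℂ) / E.eval (x : ℂ) = 0 := by
  obtain ⟨C, R₀, hC, hR₀, hb⟩ := exists_norm_eval_div_le h
  have hint := integrable_eval_div_eval h (fun x => hE x (by simp))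
  have hlim := intervalIntegral_tendsto_integral hint tendsto_neg_atTop_atBot tendsto_id
  refine tendsto_nhds_unique hlim ?_
  have h0 : Tendsto (fun R : ℝ => 4 * C / R) atTop (𝓝 0) :=
    tendsto_const_nhds.div_atTop tendsto_id
  refine squeeze_zero_norm' ?_ h0
  filter_upwards [eventually_ge_atTop R₀] with R hR
  have hRpos : 0 < R := hR₀.trans_le hR
  set F : ℂ → ℂ := fun z => f.eval z / E.eval z with hF
  have hcauchy := Complex.integral_boundary_rect_eq_zero_of_differentiableOn F
    (-R : ℝ) (R + R * Complex.I) (by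
      intro z hz
      have him : 0 ≤ z.im := by
        have := hz.2
        simp [uIcc_of_le hRpos.le] at this
        exact this.1
      exact (f.differentiableAt.div E.differentiableAt (hE z him)).differentiableWithinAt)
  have key : ∀ z : ℂ, R ≤ ‖z‖ → ‖F z‖ ≤ C / R ^ 2 := fun z hz =>
    (hb z (hR.trans hz)).trans (by gcongr)
  have htop : ‖∫ x : ℝ in (-R)..R, F (x + R * Complex.I)‖ ≤ C / R ^ 2 * |R - -R| := by
    refine intervalIntegral.norm_integral_le_of_norm_le_const fun x _ => key _ ?_
    refine le_trans ?_ (Complex.abs_im_le_norm _)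
    simp [le_abs_self]
  have hright : ‖∫ y : ℝ in (0:ℝ)..R, F (R + y * Complex.I)‖ ≤ C / R ^ 2 * |R - 0| := by
    refine intervalIntegral.norm_integral_le_of_norm_le_const fun x _ => key _ ?_
    refine le_trans ?_ (Complex.abs_re_le_norm _)
    simp [le_abs_self]
  have hleft : ‖∫ y : ℝ in (0:ℝ)..R, F (-R + y * Complex.I)‖ ≤ C / R ^ 2 * |R - 0| := by
    refine intervalIntegral.norm_integral_le_of_norm_le_const fun x _ => key _ ?_
    refine le_trans ?_ (Complex.abs_re_le_norm _)
    simp [le_abs_self]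
  simp only [Complex.ofReal_re, Complex.ofReal_im, Complex.add_re, Complex.add_im, Complex.mul_re,
    Complex.mul_im, Complex.I_re, Complex.I_im, mul_zero, mul_one, sub_zero, zero_add, add_zero,
    Complex.ofReal_zero, zero_mul, Complex.neg_re, Complex.neg_im, neg_zero, Complex.ofReal_neg, smul_eq_mul] at hcauchy
  have heq : ∫ x : ℝ in (-R)..R, F x = (∫ x : ℝ in (-R)..R, F (x + R * Complex.I))
      - Complex.I * (∫ y : ℝ in (0:ℝ)..R, F (R + y * Complex.I))
      + Complex.I * (∫ y : ℝ in (0:ℝ)..R, F (-R + y * Complex.I)) := by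
    linear_combination hcauchy
  change ‖∫ x : ℝ in (-R)..R, F x‖ ≤ _
  rw [heq]
  refine (norm_add_le _ _).trans ((add_le_add_left (norm_sub_le _ _) _).trans ?_)
  rw [norm_mul, norm_mul, Complex.norm_I, one_mul, one_mul]
  refine (add_le_add (add_le_add htop hright) hleft).trans (le_of_eq ?_)
  rw [abs_of_pos (by linarith), abs_of_pos (by linarith)]
  field_simp
  ring

/-! ### The pairing and orthogonality of the monic polynomials -/

lemma integrable_of_isCompact_support [IsFiniteMeasure μ] {F : Type*} [NormedAddCommGroup F]
    (hc : IsCompact μ.support) {f : ℝ → F} (hf : Continuous f) : Integrable f μ := by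
  obtain ⟨C, hC⟩ := hc.exists_bound_of_continuousOn hf.continuousOn
  refine Integrable.of_bound hf.aestronglyMeasurable C ?_
  filter_upwards [Measure.support_mem_ae (μ := μ)] with x hx using hC x hx

lemma integrable_pairing [IsFiniteMeasure μ] (hc : IsCompact μ.support) (p q : ℝ[X]) :
    Integrable (fun x => p.eval x * q.eval x) μ :=
  integrable_of_isCompact_support hc (p.continuous.mul q.continuous)

lemma pairing_comm (p q : ℝ[X]) : pairing μ p q = pairing μ q p := by
  simp only [pairing, mul_comm]

lemma pairing_C_mul_left (a : ℝ) (p q : ℝ[X]) : pairing μ (C a * p) q = a * pairing μ p q := by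
  simp only [pairing, eval_mul, eval_C, mul_assoc, integral_const_mul]

lemma pairing_sub_left [IsFiniteMeasure μ] (hc : IsCompact μ.support) (p q r : ℝ[X]) :
    pairing μ (p - q) r = pairing μ p r - pairing μ q r := by
  simp only [pairing, eval_sub, sub_mul]
  exact integral_sub (integrable_pairing hc _ _) (integrable_pairing hc _ _)

lemma pairing_sum_left [IsFiniteMeasure μ] (hc : IsCompact μ.support) {ι : Type*} (s : Finset ι)
    (p : ι → ℝ[X]) (r : ℝ[X]) :
    pairing μ (∑ i ∈ s, p i) r = ∑ i ∈ s, pairing μ (p i) r := by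
  simp only [pairing, eval_finsetSum, Finset.sum_mul]
  exact integral_finsetSum _ fun i _ => integrable_pairing hc _ _

lemma pairing_self_nonneg (p : ℝ[X]) : 0 ≤ pairing μ p p :=
  integral_nonneg fun _ => mul_self_nonneg _

/-- If `∫ p² dμ = 0`, then `μ` is carried by the roots of `p`, a finite closed set, which would
contain the support. -/
lemma pairing_self_pos [IsFiniteMeasure μ] (hc : IsCompact μ.support)
    (hi : μ.support.Infinite) {p : ℝ[X]} (hp : p ≠ 0) : 0 < pairing μ p p := by
  refine lt_of_le_of_ne (pairing_self_nonneg p) fun h => hi ?_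
  have h0 := (integral_eq_zero_iff_of_nonneg (fun _ => mul_self_nonneg _)
    (integrable_pairing hc p p)).1 h.symm
  have hfin : {x : ℝ | p.eval x = 0}.Finite := by
    refine p.roots.toFinset.finite_toSet.subset fun x hx => ?_
    simpa [hp] using hx
  refine hfin.subset (Measure.support_subset_of_isClosed hfin.isClosed ?_)
  filter_upwards [h0] with x hx
  simpa using hx

lemma degree_C_mul_le' {K : Type*} [Semiring K] (a : K) (p : K[X]) :
    (C a * p).degree ≤ p.degree :=
  (degree_mul_le _ _).trans ((add_le_add_left degree_C_le _).trans (zero_add _).le)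

lemma monicPoly_eq_sub (n : ℕ) : monicPoly μ n = X ^ n - ∑ k : Fin n,
    C (pairing μ (X ^ n) (monicPoly μ k) / pairing μ (monicPoly μ k) (monicPoly μ k)) *
      monicPoly μ k := by
  rw [monicPoly]

lemma monicPoly_monic_and_natDegree (n : ℕ) :
    (monicPoly μ n).Monic ∧ (monicPoly μ n).natDegree = n := by
  induction n using Nat.strong_induction_on with
  | _ n ih =>
    have hlt : (∑ k : Fin n, C (pairing μ (X ^ n) (monicPoly μ k) /
        pairing μ (monicPoly μ k) (monicPoly μ k)) * monicPoly μ k).degree < (n : ℕ) := by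
      refine (degree_sum_le _ _).trans_lt ((Finset.sup_lt_iff (WithBot.bot_lt_coe n)).2 ?_)
      intro k _
      refine (degree_C_mul_le' _ _).trans_lt ?_
      refine degree_le_natDegree.trans_lt ?_
      rw [(ih k k.2).2]
      exact WithBot.coe_lt_coe.2 k.2
    rw [monicPoly_eq_sub]
    refine ⟨monic_X_pow_sub ?_, natDegree_eq_of_degree_eq_some ?_⟩
    · exact hlt
    · rw [degree_sub_eq_left_of_degree_lt (by rwa [degree_X_pow]), degree_X_pow]

lemma monicPoly_monic (n : ℕ) : (monicPoly μ n).Monic := (monicPoly_monic_and_natDegree n).1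

lemma natDegree_monicPoly (n : ℕ) : (monicPoly μ n).natDegree = n :=
  (monicPoly_monic_and_natDegree n).2

lemma coeff_monicPoly_self (n : ℕ) : (monicPoly μ n).coeff n = 1 := by
  have := (monicPoly_monic (μ := μ) n).coeff_natDegree
  rwa [natDegree_monicPoly] at this

lemma pairing_monicPoly_self_pos [IsFiniteMeasure μ] (hc : IsCompact μ.support)
    (hi : μ.support.Infinite) (n : ℕ) : 0 < pairing μ (monicPoly μ n) (monicPoly μ n) :=
  pairing_self_pos hc hi (monicPoly_monic n).ne_zero

lemma pairing_monicPoly_of_lt [IsFiniteMeasure μ] (hc : IsCompact μ.support)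
    (hi : μ.support.Infinite) {m n : ℕ} (hmn : m < n) :
    pairing μ (monicPoly μ n) (monicPoly μ m) = 0 := by
  induction n using Nat.strong_induction_on generalizing m with
  | _ n ih =>
    rw [monicPoly_eq_sub, pairing_sub_left hc, pairing_sum_left hc,
      Finset.sum_eq_single (⟨m, hmn⟩ : Fin n)]
    · rw [pairing_C_mul_left, div_mul_cancel₀ _ (pairing_monicPoly_self_pos hc hi m).ne', sub_self]
    · intro k _ hk
      have hkm : (k : ℕ) ≠ m := fun h => hk (Fin.ext h)
      rw [pairing_C_mul_left]
      rcases lt_or_gt_of_ne hkm with h | h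
      · rw [pairing_comm (monicPoly μ k) (monicPoly μ m), ih m hmn h, mul_zero]
      · rw [ih k k.2 h, mul_zero]
    · simp

/-- Since `P_k` is monic, this removes the top coefficient; it drives the reduction of arbitrary
polynomials to the orthogonal ones. -/
lemma degree_sub_C_coeff_mul_monicPoly_lt {r : ℝ[X]} {k : ℕ} (hr : r.degree < (k + 1 : ℕ)) :
    (r - C (r.coeff k) * monicPoly μ k).degree < k := by
  rw [degree_lt_iff_coeff_zero] at hr ⊢
  intro j hj
  rcases hj.eq_or_lt with rfl | h
  · simp [coeff_monicPoly_self]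
  · rw [coeff_sub, hr j h, coeff_C_mul,
      coeff_eq_zero_of_natDegree_lt (p := monicPoly μ k) (by rwa [natDegree_monicPoly]),
      mul_zero, sub_zero]

lemma pairing_monicPoly_of_degree_lt [IsFiniteMeasure μ] (hc : IsCompact μ.support)
    (hi : μ.support.Infinite) {n : ℕ} {r : ℝ[X]} (hr : r.degree < n) :
    pairing μ r (monicPoly μ n) = 0 := by
  suffices H : ∀ k ≤ n, ∀ r : ℝ[X], r.degree < k → pairing μ r (monicPoly μ n) = 0 from
    H n le_rfl r hr
  intro k
  induction k with
  | zero =>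
    intro _ r hr
    have : r = 0 := by simpa [Nat.WithBot.lt_zero_iff] using hr
    simp [this, pairing]
  | succ k ih =>
    intro hk r hr
    have h := ih (by omega) _ (degree_sub_C_coeff_mul_monicPoly_lt (μ := μ) hr)
    rw [pairing_sub_left hc, pairing_C_mul_left, pairing_comm (monicPoly μ k),
      pairing_monicPoly_of_lt hc hi (by omega), mul_zero, sub_zero] at h
    exact h

lemma pairing_monicPoly_of_degree_lt_succ [IsFiniteMeasure μ] (hc : IsCompact μ.support)
    (hi : μ.support.Infinite) {n : ℕ} {r : ℝ[X]} (hr : r.degree < (n + 1 : ℕ)) :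
    pairing μ r (monicPoly μ n) = r.coeff n * pairing μ (monicPoly μ n) (monicPoly μ n) := by
  have h := pairing_monicPoly_of_degree_lt hc hi (degree_sub_C_coeff_mul_monicPoly_lt (μ := μ) hr)
  rw [pairing_sub_left hc, pairing_C_mul_left] at h
  linarith

/-! ### Zeros of `P_{m+1} + i P_m` -/

lemma eval_map_ofReal (p : ℝ[X]) (x : ℝ) :
    (p.map Complex.ofRealHom).eval (x : ℂ) = ((p.eval x : ℝ) : ℂ) := by
  rw [eval_map]
  exact eval₂_at_apply Complex.ofRealHom x

lemma integral_eval_mul_ofReal [IsFiniteMeasure μ] (hc : IsCompact μ.support) (w : ℂ[X])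
    (T : ℝ[X]) {m : ℕ} (hw : w.natDegree < m) :
    ∫ x, w.eval (x : ℂ) * ((T.eval x : ℝ) : ℂ) ∂μ =
      ∑ k ∈ Finset.range m, w.coeff k * (pairing μ (X ^ k) T : ℂ) := by
  have h1 : ∀ x : ℝ, w.eval (x : ℂ) * ((T.eval x : ℝ) : ℂ) =
      ∑ k ∈ Finset.range m, w.coeff k * (((X ^ k : ℝ[X]).eval x * T.eval x : ℝ) : ℂ) := by
    intro x
    rw [eval_eq_sum_range' hw, Finset.sum_mul]
    refine Finset.sum_congr rfl fun k _ => ?_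
    simp; ring
  simp only [h1]
  rw [integral_finsetSum]
  · refine Finset.sum_congr rfl fun k _ => ?_
    rw [integral_const_mul, integral_complex_ofReal, pairing]
  · exact fun k _ => ((integrable_pairing hc _ _).ofReal).const_mul _

/-- The polynomial `P_{m+1} + i P_m`. -/
noncomputable def carmonaPoly (μ : Measure ℝ) (m : ℕ) : ℂ[X] :=
  (monicPoly μ (m + 1)).map Complex.ofRealHom +
    C Complex.I * (monicPoly μ m).map Complex.ofRealHom

lemma eval_carmonaPoly (m : ℕ) (x : ℝ) : (carmonaPoly μ m).eval (x : ℂ) =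
    (((monicPoly μ (m + 1)).eval x : ℝ) : ℂ) +
      Complex.I * (((monicPoly μ m).eval x : ℝ) : ℂ) := by
  simp only [carmonaPoly, eval_add, eval_mul, eval_C, eval_map_ofReal]

lemma degree_map_monicPoly (n : ℕ) :
    ((monicPoly μ n).map Complex.ofRealHom).degree = n := by
  rw [degree_map, degree_eq_natDegree (monicPoly_monic n).ne_zero, natDegree_monicPoly]

lemma degree_I_mul_lt (m : ℕ) : (C Complex.I * (monicPoly μ m).map Complex.ofRealHom).degree <
    ((monicPoly μ (m + 1)).map Complex.ofRealHom).degree := by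
  refine (degree_C_mul_le' _ _).trans_lt ?_
  rw [degree_map_monicPoly, degree_map_monicPoly]
  exact_mod_cast Nat.lt_succ_self m

lemma carmonaPoly_monic (m : ℕ) : (carmonaPoly μ m).Monic :=
  ((monicPoly_monic (m + 1)).map _).add_of_left (degree_I_mul_lt m)

lemma natDegree_carmonaPoly (m : ℕ) : (carmonaPoly μ m).natDegree = m + 1 := by
  refine natDegree_eq_of_degree_eq_some ?_
  rw [carmonaPoly, degree_add_eq_left_of_degree_lt (degree_I_mul_lt m), degree_map_monicPoly]

/-- Suppose `D = (X - z) R`, with `R` monic of degree `m`. Orthogonality gives `∫ R̄ D dμ = i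
‖P_m‖²`, while the factorization gives `∫ (x - z) |R|² dμ`. The imaginary parts then read `‖P_m‖² =
-Im z ∫ |R|² dμ`, impossible for `Im z ≥ 0`. -/
theorem carmonaPoly_eval_ne_zero [IsFiniteMeasure μ] (hc : IsCompact μ.support)
    (hi : μ.support.Infinite) (m : ℕ) {z : ℂ} (hz : 0 ≤ z.im) :
    (carmonaPoly μ m).eval z ≠ 0 := by
  intro h0
  obtain ⟨R, hR⟩ := dvd_iff_isRoot.2 h0
  have hRm : R.Monic := (monic_X_sub_C z).of_mul_monic_left (hR ▸ carmonaPoly_monic m)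
  have hRd : R.natDegree = m := by
    have := congrArg natDegree hR
    rw [natDegree_carmonaPoly, (monic_X_sub_C z).natDegree_mul hRm, natDegree_X_sub_C] at this
    omega
  -- Conjugating coefficients yields a polynomial equal to `R̄` on the real line, so orthogonality
  -- applies to it.
  set S : ℂ[X] := R.map (starRingEnd ℂ) with hS
  have hSd : S.natDegree = m := by rw [hS, natDegree_map, hRd]
  have hSm : S.coeff m = 1 := by
    rw [hS, coeff_map, ← hRd, hRm.coeff_natDegree, map_one]
  have hSe : ∀ x : ℝ, S.eval (x : ℂ) = (starRingEnd ℂ) (R.eval (x : ℂ)) := by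
    intro x
    rw [hS, eval_map]
    conv_lhs => rw [← Complex.conj_ofReal x]
    exact eval₂_at_apply _ _
  have hA : ∫ x, S.eval (x : ℂ) * (((monicPoly μ (m + 1)).eval x : ℝ) : ℂ) ∂μ = 0 := by
    rw [integral_eval_mul_ofReal hc S _ (show S.natDegree < m + 1 by omega)]
    refine Finset.sum_eq_zero fun k hk => ?_
    rw [pairing_monicPoly_of_degree_lt hc hi, Complex.ofReal_zero, mul_zero]
    rw [degree_X_pow]; exact_mod_cast Finset.mem_range.1 hk
  have hB : ∫ x, S.eval (x : ℂ) * (((monicPoly μ m).eval x : ℝ) : ℂ) ∂μ =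
      (pairing μ (monicPoly μ m) (monicPoly μ m) : ℂ) := by
    rw [integral_eval_mul_ofReal hc S _ (show S.natDegree < m + 1 by omega),
      Finset.sum_range_succ, hSm, Finset.sum_eq_zero, zero_add, one_mul,
      pairing_monicPoly_of_degree_lt_succ hc hi]
    · simp
    · rw [degree_X_pow]; exact_mod_cast Nat.lt_succ_self m
    · intro k hk
      rw [pairing_monicPoly_of_degree_lt hc hi, Complex.ofReal_zero, mul_zero]
      rw [degree_X_pow]; exact_mod_cast Finset.mem_range.1 hk
  have hcont : Continuous fun x : ℝ => Complex.normSq (R.eval (x : ℂ)) :=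
    Complex.continuous_normSq.comp (R.continuous.comp Complex.continuous_ofReal)
  have hint1 : Integrable (fun x : ℝ => Complex.normSq (R.eval (x : ℂ))) μ :=
    integrable_of_isCompact_support hc hcont
  have hint2 : Integrable (fun x : ℝ => x * Complex.normSq (R.eval (x : ℂ))) μ :=
    integrable_of_isCompact_support hc (continuous_id.mul hcont)
  have hintS : ∀ T : ℝ[X], Integrable (fun x : ℝ => S.eval (x : ℂ) * ((T.eval x : ℝ) : ℂ)) μ :=
    fun T => integrable_of_isCompact_support hc
      ((S.continuous.comp Complex.continuous_ofReal).mul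
        (Complex.continuous_ofReal.comp T.continuous))
  have h1 : ∫ x, S.eval (x : ℂ) * (carmonaPoly μ m).eval (x : ℂ) ∂μ =
      Complex.I * (pairing μ (monicPoly μ m) (monicPoly μ m) : ℂ) := by
    rw [← hB, ← integral_const_mul, ← zero_add (∫ x, Complex.I * _ ∂μ), ← hA,
      ← integral_add (hintS _) ((hintS _).const_mul _)]
    refine integral_congr_ae (.of_forall fun x => ?_)
    simp only [eval_carmonaPoly]
    ring
  have h2 : ∫ x, S.eval (x : ℂ) * (carmonaPoly μ m).eval (x : ℂ) ∂μ =
      ((∫ x, x * Complex.normSq (R.eval (x : ℂ)) ∂μ : ℝ) : ℂ) -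
        z * ((∫ x, Complex.normSq (R.eval (x : ℂ)) ∂μ : ℝ) : ℂ) := by
    rw [← integral_complex_ofReal, ← integral_complex_ofReal, ← integral_const_mul,
      ← integral_sub hint2.ofReal (hint1.ofReal.const_mul _)]
    refine integral_congr_ae (.of_forall fun x => ?_)
    simp only [hSe, hR, eval_mul, eval_sub, eval_X, eval_C, Complex.ofReal_mul]
    rw [← Complex.mul_conj]
    ring
  have h3 := congrArg Complex.im (h1.symm.trans h2)
  simp at h3
  have h4 := pairing_monicPoly_self_pos hc hi m
  have h5 : 0 ≤ ∫ x, Complex.normSq (R.eval (x : ℂ)) ∂μ :=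
    integral_nonneg fun _ => Complex.normSq_nonneg _
  nlinarith [mul_nonneg hz h5]

/-! ### Carmona's formula -/

/-- The polynomial `P_{m+1}² + P_m²`. -/
noncomputable def carmonaDenom (μ : Measure ℝ) (m : ℕ) : ℝ[X] :=
  monicPoly μ (m + 1) ^ 2 + monicPoly μ m ^ 2

lemma eval_carmonaDenom (m : ℕ) (x : ℝ) : (carmonaDenom μ m).eval x =
    (monicPoly μ (m + 1)).eval x ^ 2 + (monicPoly μ m).eval x ^ 2 := by
  simp [carmonaDenom]

lemma natDegree_carmonaDenom (m : ℕ) : (carmonaDenom μ m).natDegree = 2 * m + 2 := by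
  rw [carmonaDenom, natDegree_add_eq_left_of_natDegree_lt, (monicPoly_monic _).natDegree_pow,
    natDegree_monicPoly]
  · ring
  · rw [(monicPoly_monic _).natDegree_pow, (monicPoly_monic _).natDegree_pow,
      natDegree_monicPoly, natDegree_monicPoly]
    omega

lemma normSq_eval_carmonaPoly (m : ℕ) (x : ℝ) :
    Complex.normSq ((carmonaPoly μ m).eval (x : ℂ)) = (carmonaDenom μ m).eval x := by
  rw [eval_carmonaPoly, eval_carmonaDenom, Complex.normSq_apply]
  simp
  ring

lemma carmonaDenom_pos [IsFiniteMeasure μ] (hc : IsCompact μ.support)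
    (hi : μ.support.Infinite) (m : ℕ) (x : ℝ) :
    0 < (carmonaDenom μ m).eval x := by
  rw [← normSq_eval_carmonaPoly, Complex.normSq_pos]
  exact carmonaPoly_eval_ne_zero hc hi m (by simp)

lemma integrable_eval_div_carmonaDenom [IsFiniteMeasure μ] (hc : IsCompact μ.support)
    (hi : μ.support.Infinite)
    {m : ℕ} {r : ℝ[X]} (hr : r.natDegree ≤ 2 * m) :
    Integrable fun x => r.eval x / (carmonaDenom μ m).eval x := by
  have h := integrable_eval_div_eval (f := r.map Complex.ofRealHom)
    (E := (carmonaDenom μ m).map Complex.ofRealHom)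
    (by rw [natDegree_map, natDegree_map, natDegree_carmonaDenom]; omega)
    (fun x => by
      rw [eval_map_ofReal]
      exact_mod_cast (carmonaDenom_pos hc hi m x).ne')
  simp only [eval_map_ofReal, ← Complex.ofReal_div] at h
  simpa using h.re

lemma eval_div_carmonaPoly (u : ℝ[X]) (m : ℕ) (x : ℝ) :
    (u.map Complex.ofRealHom).eval (x : ℂ) / (carmonaPoly μ m).eval (x : ℂ) =
      ((u * monicPoly μ (m + 1)).eval x / (carmonaDenom μ m).eval x : ℝ) -
      Complex.I * ((u * monicPoly μ m).eval x / (carmonaDenom μ m).eval x : ℝ) := by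
  rw [div_eq_mul_inv, Complex.inv_def, normSq_eval_carmonaPoly, eval_carmonaPoly, eval_map_ofReal]
  simp
  ring

/-- On the real line `u / D = u D̄ / |D|²`, whose real part is this integrand. The degree gap makes
the integral of `u / D` vanish. -/
lemma integral_mul_monicPoly_succ_div [IsFiniteMeasure μ] (hc : IsCompact μ.support)
    (hi : μ.support.Infinite)
    {m : ℕ} {u : ℝ[X]} (hu : u.natDegree + 2 ≤ m + 1) :
    ∫ x, (u * monicPoly μ (m + 1)).eval x / (carmonaDenom μ m).eval x = 0 := by
  have hdeg : (u.map Complex.ofRealHom).natDegree + 2 ≤ (carmonaPoly μ m).natDegree := by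
    rwa [natDegree_map, natDegree_carmonaPoly]
  have h := integral_eval_div_eval_eq_zero hdeg fun z hz => carmonaPoly_eval_ne_zero hc hi m hz
  have h' := integral_re (integrable_eval_div_eval hdeg
    fun x => carmonaPoly_eval_ne_zero hc hi m (by simp))
  rw [h] at h'
  simpa [eval_div_carmonaPoly, -eval_mul] using h'

/-- Here `v / D` may decay only like `b / x`, with `b` the coefficient of `v` at `m`. Subtracting `b
/ (x + i)` restores quadratic decay without poles in the closed upper half-plane; the imaginary part
of the correction supplies `b ∫ dx / (1 + x²) = π b`. -/
lemma integral_mul_monicPoly_div [IsFiniteMeasure μ] (hc : IsCompact μ.support)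
    (hi : μ.support.Infinite)
    {m : ℕ} {v : ℝ[X]} (hv : v.natDegree ≤ m) :
    ∫ x, (v * monicPoly μ m).eval x / (carmonaDenom μ m).eval x = Real.pi * v.coeff m := by
  set b := v.coeff m with hb
  have hXI : (X + C Complex.I : ℂ[X]).Monic := monic_X_add_C _
  -- With `E` below, `f / E = v / D - b / (X + i)`. The coefficients at `m + 1` cancel because `D`
  -- is monic, which leaves degree at most `m` over degree `m + 2`.
  set f : ℂ[X] := v.map Complex.ofRealHom * (X + C Complex.I) - C (b : ℂ) * carmonaPoly μ m
    with hf
  set E : ℂ[X] := carmonaPoly μ m * (X + C Complex.I) with hE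
  have hEd : E.natDegree = m + 2 := by
    rw [hE, (carmonaPoly_monic m).natDegree_mul hXI, natDegree_carmonaPoly, natDegree_X_add_C]
  have hfd : f.natDegree ≤ m := by
    rw [natDegree_le_iff_coeff_eq_zero]
    intro N hN
    obtain ⟨k, rfl⟩ : ∃ k, N = k + 1 := ⟨N - 1, by omega⟩
    have hk : m ≤ k := by omega
    rw [hf, coeff_sub, mul_add, coeff_add, coeff_mul_X, coeff_mul_C, coeff_C_mul, coeff_map,
      coeff_map, coeff_eq_zero_of_natDegree_lt (show v.natDegree < k + 1 by omega)]
    rcases hk.eq_or_lt with rfl | hlt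
    · have : (carmonaPoly μ m).coeff (m + 1) = 1 := by
        have := (carmonaPoly_monic (μ := μ) m).coeff_natDegree
        rwa [natDegree_carmonaPoly] at this
      rw [this]
      simp [hb]
    · rw [coeff_eq_zero_of_natDegree_lt (show v.natDegree < k by omega),
        coeff_eq_zero_of_natDegree_lt (p := carmonaPoly μ m)
          (by rw [natDegree_carmonaPoly]; omega)]
      simp
  have hne : ∀ z : ℂ, 0 ≤ z.im → z + Complex.I ≠ 0 := by
    intro z hz h
    have := congrArg Complex.im h
    simp at this
    linarith
  have hEne : ∀ z : ℂ, 0 ≤ z.im → E.eval z ≠ 0 := by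
    intro z hz
    rw [hE, eval_mul]
    refine mul_ne_zero (carmonaPoly_eval_ne_zero hc hi m hz) ?_
    simpa using hne z hz
  have h := integral_eval_div_eval_eq_zero (f := f) (E := E) (by omega) hEne
  have h' := integral_im (integrable_eval_div_eval (f := f) (E := E) (by omega)
    fun x => hEne x (by simp))
  rw [h] at h'
  have him : ∀ x : ℝ, RCLike.im (f.eval (x : ℂ) / E.eval (x : ℂ)) =
      b * (1 + x ^ 2)⁻¹ - (v * monicPoly μ m).eval x / (carmonaDenom μ m).eval x := by
    intro x
    have hD := carmonaPoly_eval_ne_zero hc hi m (z := (x : ℂ)) (by simp)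
    have hx := hne x (by simp)
    have h1 : f.eval (x : ℂ) / E.eval (x : ℂ) =
        (v.map Complex.ofRealHom).eval (x : ℂ) / (carmonaPoly μ m).eval (x : ℂ) -
          b * (x + Complex.I)⁻¹ := by
      simp only [hf, hE, eval_sub, eval_mul, eval_add, eval_X, eval_C]
      field_simp
    rw [h1, eval_div_carmonaPoly]
    have h2 : ((x : ℂ) + Complex.I)⁻¹.im = -(1 + x ^ 2)⁻¹ := by
      rw [Complex.inv_im, Complex.normSq_apply]
      simp
      rw [neg_div, one_div, add_comm, sq]
    rw [RCLike.im_eq_complex_im, Complex.sub_im, Complex.sub_im, Complex.im_ofReal_mul, h2]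
    simp [-eval_mul, -Complex.ofReal_div]
    ring
  simp only [him] at h'
  rw [integral_sub (integrable_inv_one_add_sq.const_mul _)
    (integrable_eval_div_carmonaDenom hc hi ?_), integral_const_mul,
    integral_univ_inv_one_add_sq] at h'
  · have : (RCLike.im (0 : ℂ) : ℝ) = 0 := by simp
    rw [this] at h'
    linarith
  · refine natDegree_mul_le.trans ?_
    rw [natDegree_monicPoly]
    omega

/-- A common complex zero, conjugated if necessary, would be a zero of `D` in the closed upper
half-plane. -/
lemma isCoprime_monicPoly [IsFiniteMeasure μ] (hc : IsCompact μ.support)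
    (hi : μ.support.Infinite) (m : ℕ) :
    IsCoprime (monicPoly μ (m + 1)) (monicPoly μ m) := by
  refine (isCoprime_iff_aeval_ne_zero_of_isAlgClosed ℝ ℂ _ _).2 ?_
  have hD : ∀ z : ℂ, 0 ≤ z.im →
      ¬ (aeval z (monicPoly μ (m + 1)) = 0 ∧ aeval z (monicPoly μ m) = 0) := by
    rintro z hz ⟨h1, h2⟩
    refine carmonaPoly_eval_ne_zero hc hi m hz ?_
    rw [aeval_def, eval₂_eq_eval_map] at h1 h2
    rw [carmonaPoly, eval_add, eval_mul]
    change eval z (Polynomial.map Complex.ofRealHom _) = 0 at h1 h2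
    rw [h1, h2, mul_zero, add_zero]
  intro z
  by_contra! hz
  rcases le_total 0 z.im with h | h
  · exact hD z h hz
  · refine hD (starRingEnd ℂ z) (by simpa using h) ?_
    rw [aeval_conj, aeval_conj, hz.1, hz.2]
    simp

/-- In `r = u P_{m+1} + v P_m` with `deg v ≤ m`, the first term integrates to zero on both sides,
and the second gives `v.coeff m` times `π` on the left and times `‖P_m‖²` under `μ`. -/
theorem integral_div_carmonaDenom [IsFiniteMeasure μ] (hc : IsCompact μ.support)
    (hi : μ.support.Infinite)
    {m : ℕ} {r : ℝ[X]} (hr : r.natDegree ≤ 2 * m) :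
    ∫ x, r.eval x / (carmonaDenom μ m).eval x =
      Real.pi / pairing μ (monicPoly μ m) (monicPoly μ m) * ∫ x, r.eval x ∂μ := by
  obtain ⟨s, t, hst⟩ := isCoprime_monicPoly hc hi m
  have hP := monicPoly_monic (μ := μ) (m + 1)
  -- Reducing the Bézout coefficient modulo `P_{m+1}` forces `deg v ≤ m`; the bound on `r` then
  -- forces `deg u ≤ m - 1` unless `u = 0`.
  set v := (r * t) %ₘ monicPoly μ (m + 1) with hv
  set u := r * s + (r * t) /ₘ monicPoly μ (m + 1) * monicPoly μ m with hu
  have hr' : r = u * monicPoly μ (m + 1) + v * monicPoly μ m := by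
    have h1 := modByMonic_add_div (r * t) (monicPoly μ (m + 1))
    linear_combination (-r) * hst - monicPoly μ m * h1
  have hvd : v.natDegree ≤ m := by
    have := natDegree_modByMonic_lt (r * t) hP
      (by intro h; have := congrArg natDegree h; rw [natDegree_monicPoly] at this; simp at this)
    rw [natDegree_monicPoly] at this
    exact Nat.lt_succ_iff.1 this
  have hvp : (v * monicPoly μ m).natDegree ≤ 2 * m := by
    refine natDegree_mul_le.trans ?_
    rw [natDegree_monicPoly]; omega
  have hup : (u * monicPoly μ (m + 1)).natDegree ≤ 2 * m := by
    have : u * monicPoly μ (m + 1) = r - v * monicPoly μ m := eq_sub_of_add_eq hr'.symm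
    rw [this]
    exact (natDegree_sub_le _ _).trans (max_le hr hvp)
  have hu0 : ∫ x, (u * monicPoly μ (m + 1)).eval x / (carmonaDenom μ m).eval x = 0 ∧
      pairing μ u (monicPoly μ (m + 1)) = 0 := by
    by_cases h0 : u = 0
    · simp [h0, pairing]
    · have hd : u.natDegree + 2 ≤ m + 1 := by
        rw [natDegree_mul h0 hP.ne_zero, natDegree_monicPoly] at hup
        omega
      refine ⟨integral_mul_monicPoly_succ_div hc hi hd, pairing_monicPoly_of_degree_lt hc hi ?_⟩
      exact degree_le_natDegree.trans_lt (by exact_mod_cast (show u.natDegree < m + 1 by omega))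
  have hv0 := integral_mul_monicPoly_div hc hi hvd
  have hv1 := pairing_monicPoly_of_degree_lt_succ hc hi (n := m) (r := v)
    (degree_le_natDegree.trans_lt (by exact_mod_cast (show v.natDegree < m + 1 by omega)))
  have hL : ∫ x, r.eval x / (carmonaDenom μ m).eval x = Real.pi * v.coeff m := by
    rw [← hv0, ← zero_add (∫ x, (v * _).eval x / _), ← hu0.1,
      ← integral_add (integrable_eval_div_carmonaDenom hc hi hup)
        (integrable_eval_div_carmonaDenom hc hi hvp)]
    refine integral_congr_ae (.of_forall fun x => ?_)
    simp only
    rw [← add_div, ← eval_add, ← hr']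
  have hM : ∫ x, r.eval x ∂μ = v.coeff m * pairing μ (monicPoly μ m) (monicPoly μ m) := by
    rw [← hv1, ← zero_add (pairing μ v _), ← hu0.2, pairing, pairing,
      ← integral_add (integrable_pairing hc _ _) (integrable_pairing hc _ _)]
    refine integral_congr_ae (.of_forall fun x => ?_)
    simp only
    rw [← eval_mul, ← eval_mul, ← eval_add, ← hr']
  rw [hL, hM]
  have := (pairing_monicPoly_self_pos hc hi m).ne'
  field_simp

lemma amplitude_succ [IsFiniteMeasure μ] (hc : IsCompact μ.support)
    (hi : μ.support.Infinite) (m : ℕ) (x : ℝ) :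
    amplitude μ (m + 1) x =
      (carmonaDenom μ m).eval x / pairing μ (monicPoly μ m) (monicPoly μ m) := by
  have h0 := pairing_monicPoly_self_pos hc hi m
  have h1 := pairing_monicPoly_self_pos hc hi (m + 1)
  have e0 := Real.sq_sqrt h0.le
  have e1 := Real.sq_sqrt h1.le
  simp only [amplitude, jacobiA, orthoPoly, polyNorm, Nat.add_sub_cancel, eval_mul, eval_C,
    eval_carmonaDenom, mul_pow, div_pow, inv_pow, e0, e1]
  field_simp

lemma amplitude_succ_pos [IsFiniteMeasure μ] (hc : IsCompact μ.support)
    (hi : μ.support.Infinite) (m : ℕ) (x : ℝ) :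
    0 < amplitude μ (m + 1) x := by
  rw [amplitude_succ hc hi]
  exact div_pos (carmonaDenom_pos hc hi m x) (pairing_monicPoly_self_pos hc hi m)

/-- The density `1 / (π (a_{m+1}² p_{m+1}² + p_m²))` of Carmona's approximation of `μ`. -/
noncomputable def carmonaDensity (μ : Measure ℝ) (m : ℕ) (x : ℝ) : ℝ :=
  (Real.pi * amplitude μ (m + 1) x)⁻¹

lemma carmonaDensity_pos [IsFiniteMeasure μ] (hc : IsCompact μ.support)
    (hi : μ.support.Infinite) (m : ℕ) (x : ℝ) :
    0 < carmonaDensity μ m x :=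
  inv_pos.2 (mul_pos Real.pi_pos (amplitude_succ_pos hc hi m x))

lemma continuous_carmonaDensity [IsFiniteMeasure μ] (hc : IsCompact μ.support)
    (hi : μ.support.Infinite) (m : ℕ) :
    Continuous (carmonaDensity μ m) := by
  refine Continuous.inv₀ (continuous_const.mul ?_)
    fun x => (mul_pos Real.pi_pos (amplitude_succ_pos hc hi m x)).ne'
  rw [funext (amplitude_succ hc hi m)]
  exact (carmonaDenom μ m).continuous.div_const _

lemma eval_mul_carmonaDensity [IsFiniteMeasure μ] (hc : IsCompact μ.support)
    (hi : μ.support.Infinite) (m : ℕ)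
    (r : ℝ[X]) (x : ℝ) : r.eval x * carmonaDensity μ m x =
      pairing μ (monicPoly μ m) (monicPoly μ m) / Real.pi *
        (r.eval x / (carmonaDenom μ m).eval x) := by
  have h0 := (pairing_monicPoly_self_pos hc hi m).ne'
  have h1 := (carmonaDenom_pos hc hi m x).ne'
  rw [carmonaDensity, amplitude_succ hc hi]
  field_simp

lemma integrable_eval_mul_carmonaDensity [IsFiniteMeasure μ] (hc : IsCompact μ.support)
    (hi : μ.support.Infinite)
    {m : ℕ} {r : ℝ[X]} (hr : r.natDegree ≤ 2 * m) :
    Integrable fun x => r.eval x * carmonaDensity μ m x := by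
  simp only [eval_mul_carmonaDensity hc hi]
  exact (integrable_eval_div_carmonaDenom hc hi hr).const_mul _

/-- **Carmona's formula**: `1 / (π (a_n² p_n² + p_{n-1}²))` has the same moments of order at most
`2n - 2` as `μ`. -/
theorem integral_eval_mul_carmonaDensity [IsFiniteMeasure μ] (hc : IsCompact μ.support)
    (hi : μ.support.Infinite)
    {m : ℕ} {r : ℝ[X]} (hr : r.natDegree ≤ 2 * m) :
    ∫ x, r.eval x * carmonaDensity μ m x = ∫ x, r.eval x ∂μ := by
  simp only [eval_mul_carmonaDensity hc hi]
  rw [integral_const_mul, integral_div_carmonaDenom hc hi hr]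
  have := (pairing_monicPoly_self_pos hc hi m).ne'
  have := Real.pi_ne_zero
  field_simp

/-! ### Convergence of Carmona's approximations to `μ` -/

lemma abs_eval_le_of_le_abs (q : ℝ[X]) {S : ℝ} (hS : 0 < S) {k : ℕ} (hk : q.natDegree ≤ 2 * k)
    {x : ℝ} (hx : S ≤ |x|) :
    |q.eval x| ≤ (∑ i ∈ Finset.range (q.natDegree + 1), |q.coeff i| * S ^ i) *
      (x / S) ^ (2 * k) := by
  rw [eval_eq_sum_range, Finset.sum_mul]
  refine (Finset.abs_sum_le_sum_abs _ _).trans (Finset.sum_le_sum fun i hi => ?_)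
  have h1 : 1 ≤ |x| / S := (one_le_div hS).2 hx
  have h2 : (|x| / S) ^ i ≤ (|x| / S) ^ (2 * k) :=
    pow_le_pow_right₀ h1 (by have := Finset.mem_range.1 hi; omega)
  have h3 : (x / S) ^ (2 * k) = (|x| / S) ^ (2 * k) := by
    rw [pow_mul, pow_mul, div_pow x, div_pow |x|, sq_abs]
  rw [h3, abs_mul, abs_pow, mul_assoc]
  refine mul_le_mul_of_nonneg_left ?_ (abs_nonneg _)
  calc |x| ^ i = S ^ i * (|x| / S) ^ i := by rw [div_pow]; field_simp
    _ ≤ _ := by gcongr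

/-- The approximating densities live on the whole line, so Weierstrass approximation on `[-S, S]`
needs tail control. The error `|f - q|` is dominated everywhere by a polynomial `B` with small
`μ`-integral; for large `m` the density integrates both `q` and `B` exactly as `μ` does. -/
theorem tendsto_integral_mul_carmonaDensity [IsProbabilityMeasure μ] (hc : IsCompact μ.support)
    (hi : μ.support.Infinite) {f : ℝ → ℝ} (hf : Continuous f) (hfs : HasCompactSupport f) :
    Tendsto (fun m => ∫ x, f x * carmonaDensity μ m x) atTop (𝓝 (∫ x, f x ∂μ)) := by
  obtain ⟨R₀, hR₀⟩ := hc.isBounded.exists_norm_le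
  obtain ⟨L, hL⟩ := hfs.isBounded.exists_norm_le
  set R := max R₀ 0 with hR
  set S := max R L + 1 with hS
  have hR0 : 0 ≤ R := le_max_right _ _
  have hRS : R < S := (le_max_left R L).trans_lt (lt_add_one _)
  have hSpos : 0 < S := hR0.trans_lt hRS
  have hae : ∀ᵐ x ∂μ, |x| ≤ R := by
    filter_upwards [Measure.support_mem_ae (μ := μ)] with x hx
      using (hR₀ x hx).trans (le_max_left _ _)
  have hf0 : ∀ x, S ≤ |x| → f x = 0 := by
    intro x hx
    by_contra h
    have h1 : |x| ≤ L := hL x (subset_tsupport f h)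
    have h2 : L < S := (le_max_right R L).trans_lt (lt_add_one _)
    linarith
  rw [Metric.tendsto_atTop]
  intro ε hε
  obtain ⟨q, hq⟩ := exists_polynomial_near_of_continuousOn (-S) S f hf.continuousOn (ε / 4)
    (by positivity)
  set K := ∑ i ∈ Finset.range (q.natDegree + 1), |q.coeff i| * S ^ i with hK
  have hK0 : 0 ≤ K := Finset.sum_nonneg fun i _ => by positivity
  -- `μ` lives on `|x| ≤ R < S`, so the tail majorant `K (x / S)^(2k)` is negligible there for large
  -- `k`, though it dominates `|q|` on `|x| ≥ S`.
  have hlim : Tendsto (fun k : ℕ => K * ((R / S) ^ 2) ^ k) atTop (𝓝 (K * 0)) := by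
    refine (tendsto_pow_atTop_nhds_zero_of_lt_one (by positivity) ?_).const_mul _
    have : R / S < 1 := (div_lt_one hSpos).2 hRS
    have h0 : 0 ≤ R / S := by positivity
    nlinarith
  rw [mul_zero] at hlim
  obtain ⟨k, hkε, hkq⟩ := ((hlim.eventually_lt_const (show 0 < ε / 4 by positivity)).and
    (eventually_ge_atTop q.natDegree)).exists
  set B : ℝ[X] := C (ε / 4) + C (K / S ^ (2 * k)) * X ^ (2 * k) with hB
  have hBd : B.natDegree ≤ 2 * k :=
    (natDegree_add_le _ _).trans (max_le (by simp) (natDegree_C_mul_X_pow_le _ _))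
  have hBe : ∀ x, B.eval x = ε / 4 + K * (x / S) ^ (2 * k) := by
    intro x
    simp only [hB, eval_add, eval_mul, eval_C, eval_pow, eval_X, div_pow]
    ring
  have hbound : ∀ x, |f x - q.eval x| ≤ B.eval x := by
    intro x
    have hpow : 0 ≤ (x / S) ^ (2 * k) := by rw [pow_mul]; positivity
    rw [hBe]
    rcases lt_or_ge |x| S with h | h
    · have := hq x ⟨(abs_lt.1 h).1.le, (abs_lt.1 h).2.le⟩
      rw [abs_sub_comm]
      have := mul_nonneg hK0 hpow
      linarith
    · rw [hf0 x h, zero_sub, abs_neg]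
      have := abs_eval_le_of_le_abs q hSpos (show q.natDegree ≤ 2 * k by omega) h
      linarith
  have hμint : ∀ p : ℝ[X], Integrable (fun x => p.eval x) μ :=
    fun p => integrable_of_isCompact_support hc p.continuous
  have hBμ : ∫ x, B.eval x ∂μ < ε / 2 := by
    have : ∫ x, B.eval x ∂μ ≤ ∫ _, (ε / 4 + K * ((R / S) ^ 2) ^ k) ∂μ := by
      refine integral_mono_ae (hμint B) (integrable_const _) ?_
      filter_upwards [hae] with x hx
      rw [hBe, pow_mul]
      have : (x / S) ^ 2 ≤ (R / S) ^ 2 := by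
        rw [div_pow, div_pow, ← sq_abs x]
        gcongr
      gcongr
    rw [integral_const, probReal_univ, one_smul] at this
    linarith
  have hfμ : |(∫ x, f x ∂μ) - ∫ x, q.eval x ∂μ| < ε / 2 := by
    rw [← integral_sub (integrable_of_isCompact_support hc hf) (hμint q),
      ← Real.norm_eq_abs]
    exact (norm_integral_le_of_norm_le (hμint B) (.of_forall hbound)).trans_lt hBμ
  refine ⟨k, fun m hm => ?_⟩
  have hqd : q.natDegree ≤ 2 * m := by omega
  have hfint : Integrable (fun x => f x * carmonaDensity μ m x) :=
    (hf.mul (continuous_carmonaDensity hc hi m)).integrable_of_hasCompactSupport hfs.mul_right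
  have hfν : |(∫ x, f x * carmonaDensity μ m x) - ∫ x, q.eval x ∂μ| < ε / 2 := by
    rw [← integral_eval_mul_carmonaDensity hc hi hqd,
      ← integral_sub hfint (integrable_eval_mul_carmonaDensity hc hi hqd),
      ← Real.norm_eq_abs]
    refine (norm_integral_le_of_norm_le (integrable_eval_mul_carmonaDensity hc hi
      (show B.natDegree ≤ 2 * m by omega)) (.of_forall fun x => ?_)).trans_lt
      (by rwa [integral_eval_mul_carmonaDensity hc hi (show B.natDegree ≤ 2 * m by omega)])
    rw [← sub_mul, Real.norm_eq_abs, abs_mul, abs_of_pos (carmonaDensity_pos hc hi m x)]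
    exact mul_le_mul_of_nonneg_right (hbound x) (carmonaDensity_pos hc hi m x).le
  rw [Real.dist_eq]
  have := abs_sub_le (∫ x, f x * carmonaDensity μ m x) (∫ x, q.eval x ∂μ) (∫ x, f x ∂μ)
  rw [abs_sub_comm (∫ x, q.eval x ∂μ)] at this
  linarith

/-! ### Comparison of measures through test functions -/

/-- Thickened indicators of a compact `K ⊆ U`, with radii small enough to stay in `U`, give the
inequality on `K`; inner regularity extends it to measurable sets. -/
lemma restrict_le_restrict_of_integral_le {μ₁ μ₂ : Measure ℝ} [IsFiniteMeasure μ₁]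
    [IsFiniteMeasure μ₂] {U : Set ℝ} (hU : IsOpen U)
    (h : ∀ f : ℝ → ℝ, Continuous f → HasCompactSupport f → (∀ x, 0 ≤ f x) → tsupport f ⊆ U →
      ∫ x, f x ∂μ₁ ≤ ∫ x, f x ∂μ₂) :
    μ₁.restrict U ≤ μ₂.restrict U := by
  have hK : ∀ K, IsCompact K → K ⊆ U → μ₁ K ≤ μ₂ K := by
    intro K hK hKU
    obtain ⟨δ, hδ, hδU⟩ := hK.exists_cthickening_subset_open hU hKU
    have hpos : ∀ n : ℕ, 0 < δ / (n + 1) := fun n => by positivity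
    have hlim : Tendsto (fun n : ℕ => δ / ((n : ℝ) + 1)) atTop (𝓝 0) :=
      tendsto_const_nhds.div_atTop
        (tendsto_atTop_add_const_right _ _ tendsto_natCast_atTop_atTop)
    have key := le_of_tendsto_of_tendsto'
      (tendsto_integral_thickenedIndicator_of_isClosed μ₁ hK.isClosed hpos hlim)
      (tendsto_integral_thickenedIndicator_of_isClosed μ₂ hK.isClosed hpos hlim) (fun n => by
        have hsub : tsupport (fun x => (thickenedIndicator (hpos n) K x : ℝ)) ⊆
            Metric.cthickening δ K := by
          refine closure_minimal (fun x hx => ?_) Metric.isClosed_cthickening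
          by_contra hx'
          refine hx ?_
          have : x ∉ Metric.thickening (δ / (n + 1)) K := fun hx2 => hx'
            (Metric.cthickening_mono (div_le_self hδ.le (by simp)) K
              (Metric.thickening_subset_cthickening _ _ hx2))
          simp [thickenedIndicator_zero (hpos n) K this]
        refine h _ ?_ ?_ (fun x => NNReal.coe_nonneg _) (hsub.trans hδU)
        · exact NNReal.continuous_coe.comp (thickenedIndicator (hpos n) K).continuous
        · exact hK.cthickening.of_isClosed_subset (isClosed_tsupport _) hsub)
    rwa [measureReal_def, measureReal_def, ENNReal.toReal_le_toReal (measure_ne_top _ _)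
      (measure_ne_top _ _)] at key
  refine Measure.le_iff.2 fun s hs => ?_
  rw [Measure.restrict_apply hs, Measure.restrict_apply hs,
    (hs.inter hU.measurableSet).measure_eq_iSup_isCompact]
  exact iSup₂_le fun K hKs => iSup_le fun hKc =>
    (hK K hKc (hKs.trans inter_subset_right)).trans (measure_mono hKs)

lemma le_of_forall_mul_le {a b : ℝ} (h : ∀ t ∈ Ioo (0 : ℝ) 1, t * a ≤ b) : a ≤ b := by
  have hlim : Tendsto (fun t : ℝ => t * a) (𝓝[<] 1) (𝓝 (1 * a)) :=
    (tendsto_id.mul_const a).mono_left nhdsWithin_le_nhds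
  rw [one_mul] at hlim
  exact le_of_tendsto hlim (by filter_upwards [Ioo_mem_nhdsLT one_pos] with t ht using h t ht)

lemma setIntegral_eq_integral_of_tsupport_subset {f ρ : ℝ → ℝ} {U : Set ℝ}
    (hfU : tsupport f ⊆ U) : ∫ x in U, f x * ρ x = ∫ x, f x * ρ x := by
  refine setIntegral_eq_integral_of_forall_compl_eq_zero fun x hx => ?_
  rw [image_eq_zero_of_notMem_tsupport fun h => hx (hfU h), zero_mul]

lemma integrableOn_mul_of_continuousOn {α β : ℝ} {f g : ℝ → ℝ} (hf : Continuous f)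
    (hg : ContinuousOn g (Icc α β)) : IntegrableOn (fun x => f x * g x) (Ioo α β) :=
  ((hf.continuousOn.mul hg).integrableOn_Icc).mono_set Ioo_subset_Icc_self

/-- The factor `t < 1` is multiplicative slack for the additive `ε` in the hypothesis on the
amplitude; it is removed at the end by `t → 1`. -/
theorem integral_le_of_eventually_carmonaDensity_le [IsProbabilityMeasure μ]
    (hc : IsCompact μ.support) (hi : μ.support.Infinite) {α β : ℝ} {g : ℝ → ℝ}
    (hg : ContinuousOn g (Icc α β))
    (h : ∀ t ∈ Ioo (0 : ℝ) 1, ∀ᶠ m in atTop, ∀ x ∈ Icc α β, t * carmonaDensity μ m x ≤ g x)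
    {f : ℝ → ℝ} (hf : Continuous f) (hfs : HasCompactSupport f) (hf0 : ∀ x, 0 ≤ f x)
    (hfU : tsupport f ⊆ Ioo α β) :
    ∫ x, f x ∂μ ≤ ∫ x in Ioo α β, f x * g x := by
  refine le_of_forall_mul_le fun t ht => ?_
  refine le_of_tendsto ((tendsto_integral_mul_carmonaDensity hc hi hf hfs).const_mul t) ?_
  filter_upwards [h t ht] with m hm
  rw [← setIntegral_eq_integral_of_tsupport_subset hfU, ← integral_const_mul]
  refine setIntegral_mono_on ((integrableOn_mul_of_continuousOn hf
    (continuous_carmonaDensity hc hi m).continuousOn).const_mul t)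
    (integrableOn_mul_of_continuousOn hf hg) measurableSet_Ioo fun x hx => ?_
  have := mul_le_mul_of_nonneg_left (hm x (Ioo_subset_Icc_self hx)) (hf0 x)
  linarith

theorem le_integral_of_eventually_le_carmonaDensity [IsProbabilityMeasure μ]
    (hc : IsCompact μ.support) (hi : μ.support.Infinite) {α β : ℝ} {g : ℝ → ℝ}
    (hg : ContinuousOn g (Icc α β))
    (h : ∀ t ∈ Ioo (0 : ℝ) 1, ∀ᶠ m in atTop, ∀ x ∈ Icc α β, t * g x ≤ carmonaDensity μ m x)
    {f : ℝ → ℝ} (hf : Continuous f) (hfs : HasCompactSupport f) (hf0 : ∀ x, 0 ≤ f x)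
    (hfU : tsupport f ⊆ Ioo α β) :
    ∫ x in Ioo α β, f x * g x ≤ ∫ x, f x ∂μ := by
  refine le_of_forall_mul_le fun t ht => ?_
  refine ge_of_tendsto (tendsto_integral_mul_carmonaDensity hc hi hf hfs) ?_
  filter_upwards [h t ht] with m hm
  rw [← setIntegral_eq_integral_of_tsupport_subset hfU, ← integral_const_mul]
  refine setIntegral_mono_on ((integrableOn_mul_of_continuousOn hf hg).const_mul t)
    (integrableOn_mul_of_continuousOn hf (continuous_carmonaDensity hc hi m).continuousOn)
    measurableSet_Ioo fun x hx => ?_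
  have := mul_le_mul_of_nonneg_left (hm x (Ioo_subset_Icc_self hx)) (hf0 x)
  linarith

/-! ### From amplitude bounds to bounds on the weight -/

lemma exists_pos_le_of_continuousOn {α β : ℝ} {f : ℝ → ℝ} (hf : ContinuousOn f (Icc α β))
    (hpos : ∀ x ∈ Icc α β, 0 < f x) : ∃ c, 0 < c ∧ ∀ x ∈ Icc α β, c ≤ f x := by
  rcases (Icc α β).eq_empty_or_nonempty with h | h
  · exact ⟨1, one_pos, by simp [h]⟩
  · obtain ⟨x, hx, hmin⟩ := isCompact_Icc.exists_isMinOn h hf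
    exact ⟨f x, hpos x hx, fun y hy => hmin hy⟩

lemma eventually_carmonaDensity_le {α β : ℝ} {fm fp : ℝ → ℝ}
    (hfm : ContinuousOn fm (Icc α β)) (hpos : ∀ x ∈ Icc α β, 0 < fm x)
    (h : UniformlyBetween (amplitude μ) (fun x => Real.pi⁻¹ * fm x) (fun x => Real.pi⁻¹ * fp x)
      (Icc α β)) {t : ℝ} (ht : t ∈ Ioo (0 : ℝ) 1) :
    ∀ᶠ m in atTop, ∀ x ∈ Icc α β, t * carmonaDensity μ m x ≤ 1 / fm x := by
  obtain ⟨c, hc0, hcm⟩ := exists_pos_le_of_continuousOn hfm hpos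
  have hπ := Real.pi_pos
  -- As `c ≤ fm`, this `ε` is at most `π⁻¹ (1 - t) fm`, turning the additive error into the factor
  -- `t`.
  obtain ⟨N, hN⟩ := h (Real.pi⁻¹ * ((1 - t) * c))
    (mul_pos (inv_pos.2 hπ) (mul_pos (by linarith [ht.2]) hc0))
  filter_upwards [eventually_ge_atTop N] with m hm x hx
  have h1 := (hN (m + 1) (by omega) x hx).1
  have hA : t * fm x ≤ Real.pi * amplitude μ (m + 1) x := by
    have h2 : (1 - t) * c ≤ (1 - t) * fm x :=
      mul_le_mul_of_nonneg_left (hcm x hx) (by linarith [ht.2])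
    have h3 := mul_le_mul_of_nonneg_left h1 hπ.le
    rw [mul_sub, mul_inv_cancel_left₀ hπ.ne', mul_inv_cancel_left₀ hπ.ne'] at h3
    linarith
  have hf := hpos x hx
  have hA0 := (mul_pos ht.1 hf).trans_le hA
  rw [carmonaDensity, ← div_eq_mul_inv, div_le_div_iff₀ hA0 hf]
  linarith

lemma eventually_le_carmonaDensity [IsFiniteMeasure μ] (hc : IsCompact μ.support)
    (hi : μ.support.Infinite) {α β : ℝ} {fm fp : ℝ → ℝ}
    (hfp : ContinuousOn fp (Icc α β)) (hpos : ∀ x ∈ Icc α β, 0 < fp x)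
    (h : UniformlyBetween (amplitude μ) (fun x => Real.pi⁻¹ * fm x) (fun x => Real.pi⁻¹ * fp x)
      (Icc α β)) {t : ℝ} (ht : t ∈ Ioo (0 : ℝ) 1) :
    ∀ᶠ m in atTop, ∀ x ∈ Icc α β, t * (1 / fp x) ≤ carmonaDensity μ m x := by
  obtain ⟨c, hc0, hcp⟩ := exists_pos_le_of_continuousOn hfp hpos
  have hπ := Real.pi_pos
  have h1t : 0 < 1 - t := by linarith [ht.2]
  obtain ⟨N, hN⟩ := h (Real.pi⁻¹ * ((1 - t) * c)) (mul_pos (inv_pos.2 hπ) (mul_pos h1t hc0))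
  filter_upwards [eventually_ge_atTop N] with m hm x hx
  have h1 := (hN (m + 1) (by omega) x hx).2
  have hf := hpos x hx
  have hA : t * (Real.pi * amplitude μ (m + 1) x) ≤ fp x := by
    have h3 := mul_le_mul_of_nonneg_left h1 hπ.le
    rw [mul_add, mul_inv_cancel_left₀ hπ.ne', mul_inv_cancel_left₀ hπ.ne'] at h3
    have h2 : (1 - t) * c ≤ (1 - t) * fp x := mul_le_mul_of_nonneg_left (hcp x hx) h1t.le
    have h4 := mul_le_mul_of_nonneg_left (h3.trans (add_le_add_right h2 _)) ht.1.le
    -- The amplitude times `π` is at most `(2 - t) fp`, and `t (2 - t) = 1 - (1 - t)² ≤ 1`.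
    nlinarith [mul_nonneg (sq_nonneg (1 - t)) hf.le]
  have hA0 := mul_pos hπ (amplitude_succ_pos hc hi m x)
  rw [carmonaDensity, mul_one_div, ← one_div, div_le_div_iff₀ hf hA0]
  linarith

theorem absolutelyContinuous_and_weight_bounds [IsProbabilityMeasure μ]
    (hc : IsCompact μ.support) (hi : μ.support.Infinite) {α β : ℝ} {fm fp : ℝ → ℝ}
    (hfm : ContinuousOn fm (Icc α β)) (hfp : ContinuousOn fp (Icc α β))
    (hfm0 : ∀ x ∈ Icc α β, 0 < fm x) (hfp0 : ∀ x ∈ Icc α β, 0 < fp x)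
    (h : UniformlyBetween (amplitude μ) (fun x => Real.pi⁻¹ * fm x) (fun x => Real.pi⁻¹ * fp x)
      (Icc α β)) :
    μ.restrict (Ioo α β) ≪ volume ∧
      ∀ᵐ x ∂(volume.restrict (Ioo α β)), 1 / fp x ≤ weight μ x ∧ weight μ x ≤ 1 / fm x := by
  set U := Ioo α β with hU
  have hUo : IsOpen U := isOpen_Ioo
  have hUm : MeasurableSet U := measurableSet_Ioo
  set κ : (ℝ → ℝ) → Measure ℝ := fun g =>
    (volume.restrict U).withDensity (fun x => ENNReal.ofReal (1 / g x)) with hκ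
  have hcont : ∀ {g : ℝ → ℝ}, ContinuousOn g (Icc α β) → (∀ x ∈ Icc α β, 0 < g x) →
      ContinuousOn (fun x => 1 / g x) (Icc α β) := fun hg hg0 =>
    continuousOn_const.div hg fun x hx => (hg0 x hx).ne'
  have hint : ∀ {g : ℝ → ℝ}, ContinuousOn g (Icc α β) → (∀ x ∈ Icc α β, 0 < g x) →
      IntegrableOn (fun x => 1 / g x) U := fun hg hg0 =>
    (hcont hg hg0).integrableOn_Icc.mono_set Ioo_subset_Icc_self
  have hfin : ∀ {g : ℝ → ℝ}, ContinuousOn g (Icc α β) → (∀ x ∈ Icc α β, 0 < g x) →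
      IsFiniteMeasure (κ g) := fun hg hg0 =>
    isFiniteMeasure_withDensity_ofReal (hint hg hg0).2
  have hκint : ∀ {g : ℝ → ℝ}, ContinuousOn g (Icc α β) → (∀ x ∈ Icc α β, 0 < g x) →
      ∀ f : ℝ → ℝ, ∫ x, f x ∂(κ g) = ∫ x in U, f x * (1 / g x) := by
    intro g hg hg0 f
    rw [hκ, integral_withDensity_eq_integral_toReal_smul₀
      (hint hg hg0).aestronglyMeasurable.aemeasurable.ennreal_ofReal
      (.of_forall fun _ => ENNReal.ofReal_lt_top)]
    refine setIntegral_congr_fun hUm fun x hx => ?_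
    have := hg0 x (Ioo_subset_Icc_self hx)
    simp only [smul_eq_mul]
    rw [ENNReal.toReal_ofReal (by positivity), mul_comm]
  have hκU : ∀ g, (κ g).restrict U = κ g := by
    intro g
    rw [hκ]
    simp only
    rw [restrict_withDensity hUm, Measure.restrict_restrict hUm, inter_self]
  have hupper : μ.restrict U ≤ κ fm := by
    have := hfin hfm hfm0
    rw [← hκU fm]
    refine restrict_le_restrict_of_integral_le hUo fun f hf hfs hf0 hfU => ?_
    rw [hκint hfm hfm0]
    exact integral_le_of_eventually_carmonaDensity_le hc hi (hcont hfm hfm0)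
      (fun t ht => eventually_carmonaDensity_le hfm hfm0 h ht) hf hfs hf0 hfU
  have hlower : κ fp ≤ μ.restrict U := by
    have := hfin hfp hfp0
    rw [← hκU fp]
    refine restrict_le_restrict_of_integral_le hUo fun f hf hfs hf0 hfU => ?_
    rw [hκint hfp hfp0]
    exact le_integral_of_eventually_le_carmonaDensity hc hi (hcont hfp hfp0)
      (fun t ht => eventually_le_carmonaDensity hc hi hfp hfp0 h ht) hf hfs hf0 hfU
  have hac : μ.restrict U ≪ volume :=
    (Measure.absolutelyContinuous_of_le hupper).trans
      ((withDensity_absolutelyContinuous _ _).trans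
        (Measure.absolutelyContinuous_of_le Measure.restrict_le_self))
  -- Absolute continuity makes `μ` on `U` equal to its density part, so the measure inequalities
  -- become integral inequalities for `μ.rnDeriv volume`.
  have hμ : μ.restrict U = (volume.restrict U).withDensity (μ.rnDeriv volume) := by
    rw [← Measure.withDensity_rnDeriv_eq _ _ hac,
      withDensity_congr_ae (Measure.rnDeriv_restrict μ volume hUm), withDensity_indicator hUm]
  refine ⟨hac, ?_⟩
  have h1 : μ.rnDeriv volume ≤ᵐ[volume.restrict U] fun x => ENNReal.ofReal (1 / fm x) := by
    refine ae_le_of_forall_setLIntegral_le_of_sigmaFinite (Measure.measurable_rnDeriv _ _)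
      fun s hs _ => ?_
    rw [← withDensity_apply _ hs, ← withDensity_apply _ hs, ← hμ]
    exact hupper s
  have h2 : (fun x => ENNReal.ofReal (1 / fp x)) ≤ᵐ[volume.restrict U] μ.rnDeriv volume := by
    refine ae_le_of_forall_setLIntegral_le_of_sigmaFinite₀
      (hint hfp hfp0).aestronglyMeasurable.aemeasurable.ennreal_ofReal fun s hs _ => ?_
    rw [← withDensity_apply _ hs, ← withDensity_apply _ hs, ← hμ]
    exact hlower s
  filter_upwards [h1, h2, ae_restrict_mem hUm] with x hx1 hx2 hxU
  have hm := hfm0 x (Ioo_subset_Icc_self hxU)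
  -- Finiteness is needed for the lower bound, since `toReal` sends `⊤` to `0`.
  have htop : μ.rnDeriv volume x ≠ ⊤ := ne_top_of_le_ne_top ENNReal.ofReal_ne_top hx1
  exact ⟨(ENNReal.ofReal_le_iff_le_toReal htop).1 hx2,
    ENNReal.toReal_le_of_le_ofReal (by positivity) hx1⟩

/-! ### Exhaustion of the open interval and the exponent -/

lemma iUnion_Ioo_add_sub_one_div (x₀ x₁ : ℝ) :
    ⋃ n : ℕ, Ioo (x₀ + 1 / ((n : ℝ) + 1)) (x₁ - 1 / ((n : ℝ) + 1)) = Ioo x₀ x₁ := by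
  ext x
  simp only [mem_iUnion, mem_Ioo]
  constructor
  · rintro ⟨n, h1, h2⟩
    have : 0 < 1 / ((n : ℝ) + 1) := by positivity
    exact ⟨by linarith, by linarith⟩
  · rintro ⟨h1, h2⟩
    obtain ⟨n, hn⟩ := exists_nat_one_div_lt (lt_min (sub_pos.2 h1) (sub_pos.2 h2))
    exact ⟨n, by linarith [hn.trans_le (min_le_left _ _)],
      by linarith [hn.trans_le (min_le_right _ _)]⟩

/-- The lower bound makes the weight positive, so `Real.log` is a true inverse of `exp` there and
both bounds become linear after taking logarithms. -/
lemma exponent_bound {x a b : ℝ} (h1 : 1 / Real.exp (2 * (a + b)) ≤ weight μ x)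
    (h2 : weight μ x ≤ 1 / Real.exp (2 * (a - b))) :
    weight μ x = Real.exp (-2 * exponent μ x) ∧ |exponent μ x - a| ≤ b := by
  rw [one_div, ← Real.exp_neg] at h1 h2
  have hw : 0 < weight μ x := (Real.exp_pos _).trans_le h1
  have h3 := (Real.le_log_iff_exp_le hw).2 h1
  have h4 := (Real.log_le_iff_le_exp hw).2 h2
  refine ⟨?_, ?_⟩
  · rw [exponent, show -2 * (-(1 / 2) * Real.log (weight μ x)) = Real.log (weight μ x) by ring,
      Real.exp_log hw]
  · rw [exponent, abs_le]
    constructor <;> linarith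

end JacobiWeight

theorem corollary1p3 (μ : Measure ℝ) [IsProbabilityMeasure μ]
    (hcompact : IsCompact μ.support) (hinfinite : μ.support.Infinite) :
    (∀ (α β : ℝ) (fm fp : ℝ → ℝ),
      ContinuousOn fm (Icc α β) → ContinuousOn fp (Icc α β) →
      (∀ x ∈ Icc α β, 0 < fm x) → (∀ x ∈ Icc α β, 0 < fp x) →
      JacobiWeight.UniformlyBetween (JacobiWeight.amplitude μ)
        (fun x => Real.pi⁻¹ * fm x) (fun x => Real.pi⁻¹ * fp x) (Icc α β) →
      μ.restrict (Ioo α β) ≪ volume ∧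
        ∀ᵐ x ∂(volume.restrict (Ioo α β)),
          1 / fp x ≤ JacobiWeight.weight μ x ∧ JacobiWeight.weight μ x ≤ 1 / fm x) ∧
    (∀ (x₀ x₁ : ℝ) (g h : ℝ → ℝ),
      ContinuousOn (fun x => Real.exp (2 * (g x - h x))) (Ioo x₀ x₁) →
      ContinuousOn (fun x => Real.exp (2 * (g x + h x))) (Ioo x₀ x₁) →
      (∀ α β : ℝ, Icc α β ⊆ Ioo x₀ x₁ →
        JacobiWeight.UniformlyBetween (JacobiWeight.amplitude μ)
          (fun x => Real.pi⁻¹ * Real.exp (2 * (g x - h x)))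
          (fun x => Real.pi⁻¹ * Real.exp (2 * (g x + h x))) (Icc α β)) →
      μ.restrict (Ioo x₀ x₁) ≪ volume ∧
        ∀ᵐ x ∂(volume.restrict (Ioo x₀ x₁)),
          JacobiWeight.weight μ x = Real.exp (-2 * JacobiWeight.exponent μ x) ∧
            |JacobiWeight.exponent μ x - g x| ≤ h x) := by
  refine ⟨fun α β fm fp hfm hfp hfm0 hfp0 h =>
    JacobiWeight.absolutelyContinuous_and_weight_bounds hcompact hinfinite hfm hfp hfm0 hfp0 h,
    fun x₀ x₁ g h hm hp hunif => ?_⟩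
  have hsub : ∀ n : ℕ, Icc (x₀ + 1 / ((n : ℝ) + 1)) (x₁ - 1 / ((n : ℝ) + 1)) ⊆ Ioo x₀ x₁ := by
    rintro n x ⟨h1, h2⟩
    have : 0 < 1 / ((n : ℝ) + 1) := by positivity
    exact ⟨by linarith, by linarith⟩
  -- The first statement applies on each compact subinterval; countably many of them exhaust the
  -- interval, so null sets are preserved.
  have key := fun n : ℕ => JacobiWeight.absolutelyContinuous_and_weight_bounds hcompact hinfinite
    (hm.mono (hsub n)) (hp.mono (hsub n)) (fun x _ => Real.exp_pos _) (fun x _ => Real.exp_pos _)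
    (hunif _ _ (hsub n))
  rw [← JacobiWeight.iUnion_Ioo_add_sub_one_div x₀ x₁]
  refine ⟨?_, ?_⟩
  · refine Measure.AbsolutelyContinuous.mk fun s hs h0 => ?_
    rw [Measure.restrict_apply hs, inter_iUnion]
    refine measure_iUnion_null fun n => ?_
    rw [← Measure.restrict_apply hs]
    exact (key n).1 h0
  · rw [ae_restrict_iUnion_iff]
    intro n
    filter_upwards [(key n).2] with x hx
    exact JacobiWeight.exponent_bound hx.1 hx.2
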